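/- **Monotonicity of the fixed-point iteration (scalar state and scalar disturbance).** Consider the system $x_{t+1}=Ax_t+B_uu_t+B_ww_t$ with $x_t\in\mathbb R$, $w_t\in\mathbb R$, $u_t\in\mathbb R^{d_u}$ (so $d_x=d_w=1$, $d_u$ arbitrary), with $(A,B_u)$ and $(A,B_w)$ stabilizable and stage cost $|x_t|^2+\|u_t\|^2$ (i.e. $Q=1$, $R=I$). Put $F(z)=(z-A)^{-1}B_u$, $G(z)=(z-A)^{-1}B_w$, let $T_K=\begin{bmatrix}FK+G\\K\end{bmatrix}$ be the closed loop under a controller $K$, let $K_\circ=-(I+F^*F)^{-1}F^*G$ be the optimal non-causal controller, and let $\gamma_\infty$ be the infimum of $\|T_K\|_\infty$ over causal bounded controllers $K\in H_\infty$ for which $T_K$ is bounded and causal. (If $A=\pm1$, the value of $T_{K_\circ}^*T_{K_\circ}$ at the frequency $e^{j\omega}=A$ is the one given by continuity.) Let $P>0$ be the stabilizing solution of $P=Q+A^\top PA-A^\top PB_u(R+B_u^\top PB_u)^{-1}B_u^\top PA$, and put $K_{\rm lqr}=(R+B_u^\top PB_u)^{-1}B_u^\top PA$, $\overline A=(A-B_uK_{\rm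 lqr})^\top$, $\overline C=-(R+B_u^\top PB_u)^{-\top/2}B_u^\top$, $\overline D=(A-B_uK_{\rm lqr})^\top PB_w$. A positive power spectral density is an integrable function $N$ on the unit circle with $N(e^{j\omega})>0$ for all $\omega$ and $\log N$ integrable. Let $\gamma>\gamma_\infty$ and define the maps - $F_3:N\mapsto L$, the canonical spectral factor of $N$: $N=L^*L$ almost everywhere, $L\in H_2$ causal and causally invertible, $L(\infty)>0$; - $F_4:L\mapsto \overline B=\frac1{2\pi}\int_0^{2\pi}(1-e^{j\omega}\overline A)^{-1}\overline D\,L(e^{j\omega})\,d\omega$; - $F_1:\overline B\mapsto S_-(e^{j\omega})=\overline C(e^{-j\omega}-\overline A)^{-1}\overline B$; - $F_{2,\gamma}:S_-\mapsto \max\left\{\dfrac{S_-(e^{j\omega})^*S_-(e^{j\omega})}{\gamma^2-T_{K_\circ}(e^{j\omega})^*T_{K_\circ}(e^{j\omega})},\,1\right\}$. Then the composite map $F_{2,\gamma}\circ F_1\circ F_4\circ F_3$ is monotone: if $N_1,N_2$ are positive power spectral densities with $0<N_1(e^{j\omega})\le N_2(e^{j\omega})$ for all $\omega\in[0,2\pi)$,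 then $$\big(F_{2,\gamma}\circ F_1\circ F_4\circ F_3\big)(N_1)(e^{j\omega})\;\le\;\big(F_{2,\gamma}\circ F_1\circ F_4\circ F_3\big)(N_2)(e^{j\omega})\qquad\text{for all }\omega\in[0,2\pi).$$ -/

import Mathlib

open MeasureTheory AddCircle
open scoped ENNReal

noncomputable section

namespace MixedControl

instance fact_two_pi_pos : Fact (0 < 2 * Real.pi) := ⟨Real.two_pi_pos⟩

/-- The circle of frequencies `ω ∈ [0, 2π)`. -/
abbrev Freq : Type := AddCircle (2 * Real.pi)

/-- Normalized Lebesgue measure `dω / 2π` on the circle of frequencies. -/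
abbrev μ : Measure Freq := haarAddCircle

/-- The point `e^{jω}` of the unit circle. -/
def z (ω : Freq) : ℂ := fourier 1 ω

/-! ### Causal functions and spectral factors -/

section Causal

variable {E : Type*} [NormedAddCommGroup E] [NormedSpace ℂ E]

/-- A transfer function `f(e^{jω}) = ∑ f_t e^{-jωt}` is causal if `f_t = 0` for every `t < 0`, that
is, if its Fourier series contains no positive power of `e^{jω}`. -/
def IsCausal (f : Freq → E) : Prop := ∀ k : ℤ, 0 < k → fourierCoeff f k = 0

/-- The Hardy space `H_p` of causal transfer functions with finite `L_p` norm on the circle. -/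
def IsHardy (p : ℝ≥0∞) (f : Freq → E) : Prop := MemLp f p μ ∧ IsCausal f

end Causal

/-- Causal invertibility of `L`: the inverse of multiplication by `L` (in general an unbounded
operator on `L_2` of the circle) maps causal functions to causal functions. If `1 / L` is in `L_2`,
this says that `1 / L` is causal. -/
def IsCausallyInvertible (L : Freq → ℂ) : Prop :=
  ∀ g : Freq → ℂ, MemLp g 2 μ → IsHardy 2 (fun ω => L ω * g ω) → IsCausal g

/-- `L` is the canonical spectral factor of the spectrum `N`: it is causal and causally invertible,
`N = L^* L` on the circle, and it is normalized to be positive at infinity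
(`L(∞)` is the zeroth Fourier coefficient). -/
structure IsSpectralFactor (N : Freq → ℝ) (L : Freq → ℂ) : Prop where
  hardy : IsHardy 2 L
  causallyInvertible : IsCausallyInvertible L
  factor : ∀ᵐ ω ∂μ, ‖L ω‖ ^ 2 = N ω
  pos_re : 0 < (fourierCoeff L 0).re
  im_eq_zero : (fourierCoeff L 0).im = 0

/-- Positive power spectral densities: positive integrable functions on the circle with the
Paley–Wiener condition `∫ log N > -∞`, which is the condition for a spectral factor to exist. It
holds for every positive continuous `N` and for every integrable `N ≥ 1`. -/
structure IsPositiveSpectrum (N : Freq → ℝ) : Prop where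
  pos : ∀ ω, 0 < N ω
  integrable : Integrable N μ
  log_integrable : Integrable (fun ω => Real.log (N ω)) μ

open Classical in
/-- The spectral factorization `F₃ : N ↦ L`. The factor is unique up to a null set. -/
def F₃ (N : Freq → ℝ) : Freq → ℂ :=
  if h : ∃ L, IsSpectralFactor N L then h.choose else 0

/-! ### The system -/

/-- The system `x_{t+1} = A x_t + B_u u_t + B_w w_t` with scalar state, scalar disturbance and
`m`-dimensional control input, and with `(A, B_u)` and `(A, B_w)` stabilizable. The cost per stage
is `|x_t|^2 + ‖u_t‖^2`, that is, `Q = 1` and `R = I`. -/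
structure ScalarSystem (m : ℕ) where
  A : ℝ
  Bu : Fin m → ℝ
  Bw : ℝ
  stabilizable_u : ∃ k : Fin m → ℝ, |A + Bu ⬝ᵥ k| < 1
  stabilizable_w : ∃ k : ℝ, |A + Bw * k| < 1

namespace ScalarSystem

variable {m : ℕ} (sys : ScalarSystem m)

/-! #### The Riccati equation -/

/-- The matrix `R + B_uᵀ P B_u`, with `R = I`. -/
def M (P : ℝ) : Matrix (Fin m) (Fin m) ℝ := 1 + P • Matrix.vecMulVec sys.Bu sys.Bu

/-- The gain `(R + B_uᵀ P B_u)⁻¹ B_uᵀ P A`. -/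
def gain (P : ℝ) : Fin m → ℝ := (sys.M P)⁻¹.mulVec ((P * sys.A) • sys.Bu)

/-- `P` is a positive stabilizing solution of the Riccati equation
`P = Q + Aᵀ P A - Aᵀ P B_u (R + B_uᵀ P B_u)⁻¹ B_uᵀ P A`. -/
structure IsRiccatiSolution (P : ℝ) : Prop where
  pos : 0 < P
  eq : P = 1 + sys.A * P * sys.A - sys.A * P * (sys.Bu ⬝ᵥ sys.gain P)
  stabilizing : |sys.A - sys.Bu ⬝ᵥ sys.gain P| < 1

theorem bu_dotProduct_gain {P : ℝ} (hP : 0 < P) :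
    sys.Bu ⬝ᵥ sys.gain P = P * sys.A * (sys.Bu ⬝ᵥ sys.Bu) / (1 + P * (sys.Bu ⬝ᵥ sys.Bu)) := by
  have hb : 0 ≤ sys.Bu ⬝ᵥ sys.Bu := Finset.sum_nonneg fun i _ => mul_self_nonneg _
  have hpos : 0 < 1 + P * (sys.Bu ⬝ᵥ sys.Bu) := by positivity
  have hmul : (sys.M P).mulVec sys.Bu = (1 + P * (sys.Bu ⬝ᵥ sys.Bu)) • sys.Bu := by
    ext i
    simp [M, Matrix.add_mulVec, Matrix.smul_mulVec, Matrix.vecMulVec_mulVec]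
    ring
  have hdet : IsUnit (sys.M P).det := by
    have h : sys.M P = 1 + Matrix.replicateCol Unit (P • sys.Bu) *
        Matrix.replicateRow Unit sys.Bu := by
      ext i j
      simp [M, Matrix.vecMulVec_apply, Matrix.mul_apply]
    rw [h, Matrix.det_one_add_replicateCol_mul_replicateRow]
    simpa using hpos.ne'
  have hinv : (sys.M P)⁻¹.mulVec sys.Bu = (1 + P * (sys.Bu ⬝ᵥ sys.Bu))⁻¹ • sys.Bu := by
    have h := congrArg (fun v => (1 + P * (sys.Bu ⬝ᵥ sys.Bu))⁻¹ • (sys.M P)⁻¹.mulVec v) hmul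
    simp only [Matrix.mulVec_mulVec, Matrix.nonsing_inv_mul _ hdet, Matrix.one_mulVec,
      Matrix.mulVec_smul, smul_smul, inv_mul_cancel₀ hpos.ne', one_smul] at h
    exact h.symm
  rw [gain, Matrix.mulVec_smul, hinv, dotProduct_smul, dotProduct_smul]
  simp only [smul_eq_mul]
  field_simp

theorem exists_isRiccatiSolution : ∃ P, sys.IsRiccatiSolution P := by
  obtain ⟨k, hk⟩ := sys.stabilizable_u
  have hb : 0 ≤ sys.Bu ⬝ᵥ sys.Bu := Finset.sum_nonneg fun i _ => mul_self_nonneg _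
  obtain ⟨P, hP, hq⟩ : ∃ P : ℝ, 0 < P ∧ P * (1 + P * (sys.Bu ⬝ᵥ sys.Bu)) =
      1 + P * (sys.Bu ⬝ᵥ sys.Bu) + sys.A ^ 2 * P := by
    rcases hb.eq_or_lt with h0 | h0
    · have hBu : sys.Bu = 0 := dotProduct_self_eq_zero.mp h0.symm
      rw [hBu, zero_dotProduct, add_zero] at hk
      have h1 : 0 < 1 - sys.A ^ 2 := by
        have := (sq_lt_one_iff_abs_lt_one sys.A).mpr hk
        linarith
      refine ⟨(1 - sys.A ^ 2)⁻¹, inv_pos.mpr h1, ?_⟩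
      rw [← h0]
      field_simp
      ring
    · generalize sys.Bu ⬝ᵥ sys.Bu = b at h0
      set c := 1 - b - sys.A ^ 2
      have hd : 0 ≤ c ^ 2 + 4 * b := by positivity
      have hs := Real.sq_sqrt hd
      have hlt : |c| < Real.sqrt (c ^ 2 + 4 * b) := by
        rw [← Real.sqrt_sq_eq_abs]
        exact Real.sqrt_lt_sqrt (sq_nonneg c) (by linarith)
      refine ⟨(-c + Real.sqrt (c ^ 2 + 4 * b)) / (2 * b), ?_, ?_⟩
      · have := le_abs_self c
        exact div_pos (by linarith) (by linarith)
      · generalize Real.sqrt (c ^ 2 + 4 * b) = s at hs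
        have hA : sys.A ^ 2 = 1 - b - c := by simp only [c]; ring
        rw [hA]
        field_simp
        nlinarith
  have hpos : 0 < 1 + P * (sys.Bu ⬝ᵥ sys.Bu) := by positivity
  have hg := sys.bu_dotProduct_gain hP
  generalize sys.Bu ⬝ᵥ sys.Bu = b at hb hq hpos hg
  refine ⟨P, hP, ?_, ?_⟩
  · rw [hg]
    field_simp
    linarith
  · have h : sys.A - sys.Bu ⬝ᵥ sys.gain P = sys.A / (1 + P * b) := by
      rw [hg]
      field_simp
      ring
    rw [h, ← sq_lt_one_iff_abs_lt_one, div_pow, div_lt_one (by positivity)]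
    have h1 : P * sys.A ^ 2 < P * (1 + P * b) ^ 2 := by
      have : 0 ≤ P * (1 + P * b) * (P * b) := by positivity
      nlinarith
    exact lt_of_mul_lt_mul_left h1 hP.le

/-- The (unique) stabilizing solution of the Riccati equation. -/
def P : ℝ := sys.exists_isRiccatiSolution.choose

/-- The LQR gain. -/
def Klqr : Fin m → ℝ := sys.gain sys.P

/-- `Ā = (A - B_u K_lqr)ᵀ` -/
def Abar : ℝ := sys.A - sys.Bu ⬝ᵥ sys.Klqr

open scoped MatrixOrder Matrix.Norms.L2Operator in
/-- `C̄ = -(R + B_uᵀ P B_u)^{-ᵀ/2} B_uᵀ`, with the positive semidefinite square root. -/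
def Cbar : Fin m → ℝ := -((CFC.sqrt (sys.M sys.P))⁻¹.transpose.mulVec sys.Bu)

/-- `D̄ = (A - B_u K_lqr)ᵀ P B_w` -/
def Dbar : ℝ := (sys.A - sys.Bu ⬝ᵥ sys.Klqr) * sys.P * sys.Bw

/-! #### Transfer functions -/

/-- The transfer function `F(e^{jω}) = (e^{jω} - A)⁻¹ B_u` from the control input to the state
(a row vector). -/
def F (ω : Freq) : Fin m → ℂ := fun i => (z ω - sys.A)⁻¹ * sys.Bu i

/-- The transfer function `G(e^{jω}) = (e^{jω} - A)⁻¹ B_w` from the disturbance to the state. -/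
def G (ω : Freq) : ℂ := (z ω - sys.A)⁻¹ * sys.Bw

/-- The non-causal controller `K_∘ = -(I + F^* F)⁻¹ F^* G`. -/
def Knc (ω : Freq) : Fin m → ℂ :=
  -((1 + Matrix.vecMulVec (star (sys.F ω)) (sys.F ω))⁻¹.mulVec (sys.G ω • star (sys.F ω)))

/-- The scalar `T_{K_∘}(e^{jω})^* T_{K_∘}(e^{jω})`, where `T_K = [F K + G; K]`. If `A = ±1`, then
`F` and `G` have a pole at the frequency `e^{jω} = A`; the product has a removable singularity
there, and its value is defined by continuity. -/
def TncSq : Freq → ℝ :=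
  extendFrom {ω | z ω ≠ sys.A}
    (fun ω => ‖sys.F ω ⬝ᵥ sys.Knc ω + sys.G ω‖ ^ 2 + ∑ i, ‖sys.Knc ω i‖ ^ 2)

/-- The closed-loop transfer function `F K + G` from the disturbance to the state. -/
def closedLoopState (K : Freq → EuclideanSpace ℂ (Fin m)) (ω : Freq) : ℂ :=
  ∑ i, sys.F ω i * K ω i + sys.G ω

/-- The `H_∞` norm of the closed loop `T_K = [F K + G; K]`. -/
def closedLoopNorm (K : Freq → EuclideanSpace ℂ (Fin m)) : ℝ≥0∞ :=
  eLpNorm (fun ω => Real.sqrt (‖sys.closedLoopState K ω‖ ^ 2 + ‖K ω‖ ^ 2)) ∞ μ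

/-- The optimal `H_∞` norm `γ_∞`: the infimum of `‖T_K‖_∞` over the causal bounded controllers
`K ∈ H_∞`. The closed loop counts only if it is bounded as a causal operator, so that the map from
the disturbance to the state also has to be in `H_∞`. -/
def gammaInf : ℝ≥0∞ :=
  ⨅ (K : Freq → EuclideanSpace ℂ (Fin m)) (_ : IsHardy ∞ K) (_ : IsHardy ∞ (sys.closedLoopState K)),
    sys.closedLoopNorm K

/-! #### The iteration -/

/-- `F₁ : B̄ ↦ S₋`, where `S₋(e^{jω}) = C̄ (e^{-jω} - Ā)⁻¹ B̄`. -/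
def F₁ (Bbar : ℂ) : Freq → Fin m → ℂ :=
  fun ω i => sys.Cbar i * ((z ω)⁻¹ - sys.Abar)⁻¹ * Bbar

/-- `F_{2,γ} : S₋ ↦ N`, where `N = max {S₋^* S₋ / (γ² - T_{K_∘}^* T_{K_∘}), 1}`. -/
def F₂ (γ : ℝ) (S : Freq → Fin m → ℂ) : Freq → ℝ :=
  fun ω => max ((∑ i, ‖S ω i‖ ^ 2) / (γ ^ 2 - sys.TncSq ω)) 1

/-- `F₄ : L ↦ B̄ = (1 / 2π) ∫ (1 - e^{jω} Ā)⁻¹ D̄ L(e^{jω}) dω`. -/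
def F₄ (L : Freq → ℂ) : ℂ :=
  ∫ ω, (1 - z ω * sys.Abar)⁻¹ * sys.Dbar * L ω ∂μ

end ScalarSystem

end MixedControl

end

noncomputable section

namespace MixedControl

/-! Since `B̄` is a scalar, `S₋` is a fixed vector function times `B̄`, so `F₂ ∘ F₁` sees only
`‖B̄‖`. It is monotone in `‖B̄‖` as soon as `γ² - T_{K_∘}^* T_{K_∘}` is positive at every frequency.
That holds because `K_∘` minimizes the cost pointwise: any level above `γ_∞` is attained by some
controller, which bounds `TncSq` almost everywhere, and continuity extends the bound to all
frequencies (`tncSq_le_of_gammaInf_lt`).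

It remains to compare `‖B̄‖`. Because `|Ā| < 1`, the integral defining `B̄` is a Cauchy integral:
`B̄ = D̄ · L(1/Ā)`, an evaluation outside the unit disc (at infinity if `Ā = 0`). The quotient `h =
L₁/L₂` has modulus at most one on the circle and is causal because `L₂` is causally invertible.
Evaluation is multiplicative (`causalEval_mul`), and the maximum principle gives `|h(1/Ā)| ≤ 1`,
hence `|L₁(1/Ā)| ≤ |L₂(1/Ā)|`.

`F₃` returns zero when there is no spectral factor, so existence must be proved too. Following
Szegő, project `√N` onto the closed span of its strict delays in `L²`. The residual `v` (the
innovation) is nonzero because `∫ log N > -∞`, and orthogonality forces `|v|` to be constant. Then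
`L = conj v · √N / ‖v‖` is the factor. -/

theorem continuous_z : Continuous z := (fourier 1 : C(Freq, ℂ)).continuous

theorem norm_z (ω : Freq) : ‖z ω‖ = 1 := by
  rw [z, fourier_one, Circle.norm_coe]

theorem z_ne_zero (ω : Freq) : z ω ≠ 0 := by
  intro h
  simpa [h] using norm_z ω

theorem z_injective : Function.Injective z := by
  intro x y h
  simp only [z, fourier_one] at h
  exact AddCircle.injective_toCircle Real.two_pi_pos.ne' (Circle.ext h)

instance nullSingletonClass_μ : NullSingletonClass μ := by
  constructor
  intro x
  have h : (volume : Measure Freq) {x} = 0 := by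
    have := AddCircle.volume_closedBall (T := 2 * Real.pi) (x := x) 0
    simpa using this
  rw [volume_eq_smul_haarAddCircle, Measure.smul_apply, smul_eq_mul, mul_eq_zero] at h
  rcases h with h | h
  · exact absurd h (by simpa using Real.pi_pos)
  · exact h

theorem ae_z_ne (a : ℂ) : ∀ᵐ ω ∂μ, z ω ≠ a := by
  have h : ({a} : Set ℂ).Finite := Set.finite_singleton a
  have := (h.preimage z_injective.injOn).measure_zero μ
  rw [ae_iff]
  simpa only [ne_eq, not_not] using! this

/-! ### The non-causal cost and its comparison with `γ_∞` -/

namespace ScalarSystem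

variable {m : ℕ} (sys : ScalarSystem m)

theorem isRiccatiSolution_P : sys.IsRiccatiSolution sys.P :=
  sys.exists_isRiccatiSolution.choose_spec

theorem abs_Abar_lt_one : |sys.Abar| < 1 := sys.isRiccatiSolution_P.stabilizing

/-- `‖F‖²` as a complex number. -/
theorem F_dotProduct_star (ω : Freq) :
    sys.F ω ⬝ᵥ star (sys.F ω) = ((∑ i, ‖sys.F ω i‖ ^ 2 : ℝ) : ℂ) := by
  simp [dotProduct, Complex.mul_conj, Complex.normSq_eq_norm_sq]

/-- `I + F^*F` is a rank-one perturbation of the identity with eigenvector `F^*` and eigenvalue `1 +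
‖F‖²`, so its inverse acts on `F^*` as division by that scalar. -/
theorem Knc_eq (ω : Freq) :
    sys.Knc ω = -((sys.G ω / ((1 + ∑ i, ‖sys.F ω i‖ ^ 2 : ℝ) : ℂ)) • star (sys.F ω)) := by
  set φ : ℝ := ∑ i, ‖sys.F ω i‖ ^ 2 with hφ
  have hφ0 : 0 ≤ φ := Finset.sum_nonneg fun i _ => by positivity
  have hpos : ((1 + φ : ℝ) : ℂ) ≠ 0 := by
    exact_mod_cast (by positivity : (0 : ℝ) < 1 + φ).ne'
  set W := (1 + Matrix.vecMulVec (star (sys.F ω)) (sys.F ω)) with hW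
  have hmul : W.mulVec (star (sys.F ω)) = ((1 + φ : ℝ) : ℂ) • star (sys.F ω) := by
    rw [hW, Matrix.add_mulVec, Matrix.one_mulVec, Matrix.vecMulVec_mulVec, F_dotProduct_star,
      ← hφ]
    ext i
    simp
    ring
  have hdet : IsUnit W.det := by
    have h : W = 1 + Matrix.replicateCol Unit (star (sys.F ω)) *
        Matrix.replicateRow Unit (sys.F ω) := by
      ext i j
      simp [hW, Matrix.vecMulVec_apply, Matrix.mul_apply]
    rw [h, Matrix.det_one_add_replicateCol_mul_replicateRow, F_dotProduct_star, ← hφ]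
    simpa using hpos
  have hinv : W⁻¹.mulVec (star (sys.F ω)) = ((1 + φ : ℝ) : ℂ)⁻¹ • star (sys.F ω) := by
    have h := congrArg (fun v => ((1 + φ : ℝ) : ℂ)⁻¹ • W⁻¹.mulVec v) hmul
    simp only [Matrix.mulVec_mulVec, Matrix.nonsing_inv_mul _ hdet, Matrix.one_mulVec,
      Matrix.mulVec_smul, smul_smul, inv_mul_cancel₀ hpos, one_smul] at h
    exact h.symm
  rw [Knc, ← hW, Matrix.mulVec_smul, hinv, smul_smul, div_eq_mul_inv]

theorem noncausal_cost_eq (ω : Freq) :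
    ‖sys.F ω ⬝ᵥ sys.Knc ω + sys.G ω‖ ^ 2 + ∑ i, ‖sys.Knc ω i‖ ^ 2 =
      ‖sys.G ω‖ ^ 2 / (1 + ∑ i, ‖sys.F ω i‖ ^ 2) := by
  rw [Knc_eq, dotProduct_neg, dotProduct_smul, F_dotProduct_star]
  have hφ0 : 0 ≤ ∑ i, ‖sys.F ω i‖ ^ 2 := Finset.sum_nonneg fun i _ => by positivity
  have hsum : ∀ c : ℂ, ∑ i, ‖(-(c • star (sys.F ω))) i‖ ^ 2 =
      ‖c‖ ^ 2 * ∑ i, ‖sys.F ω i‖ ^ 2 := by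
    intro c
    simp [mul_pow, Finset.mul_sum]
  rw [hsum]
  generalize ∑ i, ‖sys.F ω i‖ ^ 2 = φ at hφ0
  have hpos : 0 < 1 + φ := by positivity
  have hc : ((1 + φ : ℝ) : ℂ) ≠ 0 := by exact_mod_cast hpos.ne'
  have h1 : -(sys.G ω / ((1 + φ : ℝ) : ℂ)) • (φ : ℂ) + sys.G ω =
      sys.G ω / ((1 + φ : ℝ) : ℂ) := by
    rw [smul_eq_mul]
    field_simp
    push_cast
    ring
  rw [← neg_smul, h1, norm_div, Complex.norm_real, Real.norm_of_nonneg hpos.le]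
  field_simp

/-- Pointwise optimality of `K_∘`: Cauchy–Schwarz replaces `‖k‖²` by `|Fk|²/‖F‖²`, and what remains
is an inequality between real numbers. -/
theorem noncausal_cost_le (ω : Freq) (k : EuclideanSpace ℂ (Fin m)) :
    ‖sys.G ω‖ ^ 2 / (1 + ∑ i, ‖sys.F ω i‖ ^ 2) ≤
      ‖∑ i, sys.F ω i * k i + sys.G ω‖ ^ 2 + ‖k‖ ^ 2 := by
  have hφ0 : 0 ≤ ∑ i, ‖sys.F ω i‖ ^ 2 := Finset.sum_nonneg fun i _ => by positivity
  have hcs : ‖∑ i, sys.F ω i * k i‖ ^ 2 ≤ (∑ i, ‖sys.F ω i‖ ^ 2) * ‖k‖ ^ 2 := by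
    rw [EuclideanSpace.norm_sq_eq]
    refine le_trans ?_ (Finset.sum_mul_sq_le_sq_mul_sq _ _ _)
    gcongr
    exact (norm_sum_le _ _).trans_eq (by simp)
  have htri : ‖sys.G ω‖ ≤ ‖∑ i, sys.F ω i * k i + sys.G ω‖ + ‖∑ i, sys.F ω i * k i‖ := by
    have := norm_sub_le (∑ i, sys.F ω i * k i + sys.G ω) (∑ i, sys.F ω i * k i)
    rwa [add_sub_cancel_left] at this
  generalize ∑ i, ‖sys.F ω i‖ ^ 2 = φ at *
  generalize ‖∑ i, sys.F ω i * k i + sys.G ω‖ = x at *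
  have hy := norm_nonneg (∑ i, sys.F ω i * k i)
  generalize ‖∑ i, sys.F ω i * k i‖ = y at *
  generalize ‖k‖ = κ at *
  have hg := norm_nonneg (sys.G ω)
  generalize ‖sys.G ω‖ = g at *
  rw [div_le_iff₀ (by positivity)]
  have h1 : g ^ 2 ≤ (x + y) ^ 2 := by gcongr
  rcases hφ0.eq_or_lt with h0 | h0
  · subst h0
    have : y = 0 := by nlinarith
    subst this
    nlinarith [sq_nonneg κ]
  · have h2 : y ^ 2 / φ ≤ κ ^ 2 := by rwa [div_le_iff₀ h0, mul_comm]
    -- Cauchy–Schwarz with weights `1` and `φ`; the defect is the square `(φx - y)²/φ`.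
    have h3 : (x + y) ^ 2 ≤ (x ^ 2 + y ^ 2 / φ) * (1 + φ) := by
      have : (x ^ 2 + y ^ 2 / φ) * (1 + φ) - (x + y) ^ 2 = (φ * x - y) ^ 2 / φ := by
        field_simp
        ring
      have h4 : 0 ≤ (φ * x - y) ^ 2 / φ := by positivity
      linarith
    exact h1.trans (h3.trans (by gcongr))

/-- If `B_u = 0`, stabilizability forces `|A| < 1`, so `A` is off the circle. Clearing the pole of
`F` and `G` thus leaves a formula that is continuous everywhere. -/
theorem tncSq_denom_pos (ω : Freq) : 0 < ‖z ω - sys.A‖ ^ 2 + sys.Bu ⬝ᵥ sys.Bu := by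
  have hb : 0 ≤ sys.Bu ⬝ᵥ sys.Bu := Finset.sum_nonneg fun i _ => mul_self_nonneg _
  rcases hb.eq_or_lt with h0 | h0
  · have hBu : sys.Bu = 0 := dotProduct_self_eq_zero.mp h0.symm
    obtain ⟨k, hk⟩ := sys.stabilizable_u
    rw [hBu, zero_dotProduct, add_zero] at hk
    have hne : z ω - sys.A ≠ 0 := by
      intro h
      have h1 : ‖z ω‖ = |sys.A| := by rw [sub_eq_zero.mp h, Complex.norm_real, Real.norm_eq_abs]
      rw [norm_z] at h1
      linarith
    have := norm_pos_iff.mpr hne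
    positivity
  · positivity

theorem noncausal_cost_eq_div {ω : Freq} (hω : z ω ≠ sys.A) :
    ‖sys.G ω‖ ^ 2 / (1 + ∑ i, ‖sys.F ω i‖ ^ 2) =
      sys.Bw ^ 2 / (‖z ω - sys.A‖ ^ 2 + sys.Bu ⬝ᵥ sys.Bu) := by
  have hn : 0 < ‖z ω - sys.A‖ := norm_pos_iff.mpr (sub_ne_zero.mpr hω)
  have hb : 0 ≤ sys.Bu ⬝ᵥ sys.Bu := Finset.sum_nonneg fun i _ => mul_self_nonneg _
  have hF : ∑ i, ‖sys.F ω i‖ ^ 2 = (‖z ω - sys.A‖ ^ 2)⁻¹ * (sys.Bu ⬝ᵥ sys.Bu) := by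
    simp only [F, norm_mul, norm_inv, mul_pow, inv_pow, Complex.norm_real, Real.norm_eq_abs, sq_abs,
      dotProduct, Finset.mul_sum, pow_two (sys.Bu _)]
  rw [hF]
  simp only [G, norm_mul, norm_inv, mul_pow, inv_pow, Complex.norm_real, Real.norm_eq_abs, sq_abs]
  field_simp

theorem continuous_tncSq_formula :
    Continuous fun ω : Freq => sys.Bw ^ 2 / (‖z ω - sys.A‖ ^ 2 + sys.Bu ⬝ᵥ sys.Bu) :=
  continuous_const.div ((((continuous_z.sub continuous_const).norm).pow 2).add continuous_const)
    fun ω => (sys.tncSq_denom_pos ω).ne'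

/-- The frequencies off the pole have full measure, hence are dense, so the extension by continuity
agrees with the continuous formula. -/
theorem tncSq_eq (ω : Freq) :
    sys.TncSq ω = sys.Bw ^ 2 / (‖z ω - sys.A‖ ^ 2 + sys.Bu ⬝ᵥ sys.Bu) := by
  refine extendFrom_eq ?_ ?_
  · have : Dense {ω | z ω ≠ sys.A} := Measure.dense_of_ae (μ := μ) (ae_z_ne _)
    exact this ω
  · have h := (sys.continuous_tncSq_formula.tendsto ω).mono_left
      (nhdsWithin_le_nhds (s := {ω | z ω ≠ sys.A}))
    refine h.congr' ?_
    filter_upwards [self_mem_nhdsWithin] with x hx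
    rw [noncausal_cost_eq, noncausal_cost_eq_div sys hx]

/-- Every level above the optimal causal level dominates the non-causal one at all frequencies. -/
theorem tncSq_le_of_gammaInf_lt {γ : ℝ} (hγ : sys.gammaInf < ENNReal.ofReal γ) (ω : Freq) :
    sys.TncSq ω ≤ γ ^ 2 := by
  have hγ0 : 0 < γ := ENNReal.ofReal_pos.mp (bot_le.trans_lt hγ)
  simp only [gammaInf, iInf_lt_iff] at hγ
  obtain ⟨K, -, -, hK⟩ := hγ
  have hae : ∀ᵐ ω ∂μ,
      sys.Bw ^ 2 / (‖z ω - sys.A‖ ^ 2 + sys.Bu ⬝ᵥ sys.Bu) ≤ γ ^ 2 := by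
    rw [closedLoopNorm, eLpNorm_exponent_top] at hK
    filter_upwards [ae_lt_of_essSup_lt hK, ae_z_ne sys.A] with x hx hzx
    rw [← noncausal_cost_eq_div sys hzx]
    refine (sys.noncausal_cost_le x (K x)).trans ?_
    rw [← ofReal_norm, ENNReal.ofReal_lt_ofReal_iff hγ0,
      Real.norm_of_nonneg (Real.sqrt_nonneg _), Real.sqrt_lt' hγ0] at hx
    exact hx.le
  rw [tncSq_eq]
  have hd : Dense {ω : Freq | sys.Bw ^ 2 / (‖z ω - sys.A‖ ^ 2 + sys.Bu ⬝ᵥ sys.Bu) ≤ γ ^ 2} :=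
    Measure.dense_of_ae hae
  have hcl := isClosed_le sys.continuous_tncSq_formula (continuous_const (y := γ ^ 2))
  exact hcl.closure_subset (hd ω)

/-- Strictness comes from applying the weak bound at a level strictly between `γ_∞` and `γ`. -/
theorem tncSq_lt_of_gammaInf_lt {γ : ℝ} (hγ : sys.gammaInf < ENNReal.ofReal γ) (ω : Freq) :
    sys.TncSq ω < γ ^ 2 := by
  obtain ⟨c, h1, h2⟩ := ENNReal.lt_iff_exists_nnreal_btwn.mp hγ
  rw [← ENNReal.ofReal_coe_nnreal] at h1 h2
  have hc : (c : ℝ) < γ := (ENNReal.ofReal_lt_ofReal_iff' .. |>.mp h2).1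
  exact (sys.tncSq_le_of_gammaInf_lt h1 ω).trans_lt (by gcongr)

/-- `F₂ ∘ F₁` is monotone in the modulus of `B̄`. -/
theorem F₂_F₁_le {γ : ℝ} (hγ : sys.gammaInf < ENNReal.ofReal γ) {b₁ b₂ : ℂ} (hb : ‖b₁‖ ≤ ‖b₂‖)
    (ω : Freq) : sys.F₂ γ (sys.F₁ b₁) ω ≤ sys.F₂ γ (sys.F₁ b₂) ω := by
  have h := sys.tncSq_lt_of_gammaInf_lt hγ ω
  simp only [F₂, F₁, norm_mul]
  have : 0 < γ ^ 2 - sys.TncSq ω := by linarith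
  gcongr

end ScalarSystem

/-! ### Causality through moments, and products of causal functions -/

theorem fourier_eq_z_zpow (n : ℤ) (ω : Freq) : (fourier n ω : ℂ) = z ω ^ n := by
  rw [z, fourier_one, fourier_apply, toCircle_zsmul, Circle.coe_zpow]

theorem fourierCoeff_eq_integral_z (f : Freq → ℂ) (k : ℤ) :
    fourierCoeff f k = ∫ ω, z ω ^ (-k) * f ω ∂μ := by
  simp only [fourierCoeff, fourier_eq_z_zpow, smul_eq_mul]

theorem isCausal_iff_integral_z (f : Freq → ℂ) :
    IsCausal f ↔ ∀ n : ℕ, ∫ ω, (z ω)⁻¹ ^ (n + 1) * f ω ∂μ = 0 := by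
  have h (n : ℕ) : ∫ ω, (z ω)⁻¹ ^ (n + 1) * f ω ∂μ = fourierCoeff f ((n : ℤ) + 1) := by
    rw [fourierCoeff_eq_integral_z]
    congr! 3 with ω
    rw [inv_pow, zpow_neg, ← zpow_natCast]
    push_cast
    rfl
  constructor
  · intro hf n
    rw [h]
    exact hf _ (by positivity)
  · intro hf k hk
    obtain ⟨n, rfl⟩ : ∃ n : ℕ, k = (n : ℤ) + 1 := ⟨(k - 1).toNat, by omega⟩
    rw [← h]
    exact hf n

theorem IsCausal.congr_ae {f g : Freq → ℂ} (hf : IsCausal f) (h : f =ᵐ[μ] g) : IsCausal g := by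
  intro k hk
  rw [← fourierCoeff_congr_ae h]
  exact hf k hk

theorem IsHardy.congr_ae {p : ℝ≥0∞} {f g : Freq → ℂ} (hf : IsHardy p f) (h : f =ᵐ[μ] g) :
    IsHardy p g :=
  ⟨(memLp_congr_ae h).mp hf.1, hf.2.congr_ae h⟩

theorem integral_z_inv_pow_succ (n : ℕ) : ∫ ω, (z ω)⁻¹ ^ (n + 1) ∂μ = 0 := by
  have h := congrFun (fourierCoeff_fourier (T := 2 * Real.pi) 0) ((n : ℤ) + 1)
  rw [fourierCoeff_eq_integral_z, Pi.single_eq_of_ne (by positivity)] at h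
  rw [← h]
  congr! 2 with ω
  rw [fourier_zero, mul_one, zpow_neg, inv_pow, ← zpow_natCast]
  push_cast
  rfl

theorem isCausal_const (c : ℂ) : IsCausal fun _ => c := by
  rw [isCausal_iff_integral_z]
  intro n
  rw [integral_mul_const, integral_z_inv_pow_succ, zero_mul]

theorem _root_.MeasureTheory.MemLp.continuous_mul {p : ℝ≥0∞} {φ f : Freq → ℂ} (hf : MemLp f p μ)
    (hφ : Continuous φ) : MemLp (fun ω => φ ω * f ω) p μ := by
  obtain ⟨C, hC⟩ := isCompact_univ.exists_bound_of_continuousOn hφ.continuousOn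
  refine MemLp.of_le_mul (c := C) hf (hφ.aestronglyMeasurable.mul hf.1) (ae_of_all _ fun ω => ?_)
  rw [norm_mul]
  gcongr
  exact hC ω trivial

theorem continuous_z_inv : Continuous fun ω => (z ω)⁻¹ :=
  continuous_z.inv₀ z_ne_zero

theorem continuous_z_inv_pow (n : ℕ) : Continuous fun ω => (z ω)⁻¹ ^ n :=
  continuous_z_inv.pow n

theorem L2_inner_toLp {f g : Freq → ℂ} (hf : MemLp f 2 μ) (hg : MemLp g 2 μ) :
    inner ℂ (hf.toLp f) (hg.toLp g) = ∫ ω, (starRingEnd ℂ) (f ω) * g ω ∂μ := by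
  rw [L2.inner_def]
  refine integral_congr_ae ?_
  filter_upwards [hf.coeFn_toLp, hg.coeFn_toLp] with ω h1 h2
  rw [h1, h2, RCLike.inner_apply, mul_comm]

theorem memLp_conj {p : ℝ≥0∞} {f : Freq → ℂ} (hf : MemLp f p μ) :
    MemLp (fun ω => (starRingEnd ℂ) (f ω)) p μ :=
  hf.star

/-- The product of two functions of the Hardy space `H²` is causal. -/
theorem IsHardy.isCausal_mul {f g : Freq → ℂ} (hf : IsHardy 2 f) (hg : IsHardy 2 g) :
    IsCausal fun ω => f ω * g ω := by
  intro k hk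
  -- With this conjugate, Parseval's identity becomes the convolution formula: coefficient `k` of `f
  -- g` is the sum over `n` of `f̂(k - n) ĝ(n)`.
  have hu : MemLp (fun ω => (starRingEnd ℂ) (fourier (-k) ω * f ω)) 2 μ :=
    memLp_conj (hf.1.continuous_mul (fourier (-k)).continuous)
  have hsum := fourierBasis.hasSum_inner_mul_inner (hu.toLp _) (hg.1.toLp g)
  have hint : inner ℂ (hu.toLp _) (hg.1.toLp g) = fourierCoeff (fun ω => f ω * g ω) k := by
    rw [L2_inner_toLp, fourierCoeff]
    congr! 2 with ω
    rw [Complex.conj_conj, smul_eq_mul, mul_assoc]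
  rw [hint] at hsum
  refine hsum.unique ?_
  convert! hasSum_zero using 1
  ext n
  have h1 : inner ℂ (fourierBasis n) (hg.1.toLp g) = fourierCoeff g n := by
    rw [← HilbertBasis.repr_apply_apply, fourierBasis_repr]
    exact congrFun (fourierCoeff_congr_ae hg.1.coeFn_toLp) n
  have h2 : inner ℂ (hu.toLp _) (fourierBasis (T := 2 * Real.pi) n) = fourierCoeff f (k - n) := by
    rw [coe_fourierBasis, L2.inner_def, fourierCoeff]
    refine integral_congr_ae ?_
    filter_upwards [hu.coeFn_toLp, coeFn_fourierLp 2 n] with ω h1 h2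
    rw [h1, h2, RCLike.inner_apply, Complex.conj_conj, smul_eq_mul, ← mul_assoc, ← fourier_add]
    congr 3
    ring
  rw [h1, h2]
  -- For `k > 0`, at least one of `k - n` and `n` is positive.
  rcases le_or_gt n 0 with hn | hn
  · rw [hf.2 _ (by omega), zero_mul]
  · rw [hg.2 _ hn, mul_zero]

/-! ### Evaluation of causal functions at a point outside the unit disc -/

/-- The Cauchy kernel `(1 - a e^{jω})⁻¹`. -/
def cauchyKernel (a : ℝ) (ω : Freq) : ℂ := (1 - z ω * a)⁻¹

/-- The value at `1 / a` of the analytic extension of a causal function. -/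
def causalEval (a : ℝ) (f : Freq → ℂ) : ℂ := ∫ ω, cauchyKernel a ω * f ω ∂μ

variable {a : ℝ}

theorem one_sub_z_mul_ne_zero (ha : |a| < 1) (ω : Freq) : 1 - z ω * a ≠ 0 := by
  intro h
  have h1 : ‖z ω * a‖ = 1 := by rw [← sub_eq_zero.mp h, norm_one]
  rw [norm_mul, norm_z, one_mul, Complex.norm_real, Real.norm_eq_abs] at h1
  linarith

theorem continuous_cauchyKernel (ha : |a| < 1) : Continuous (cauchyKernel a) :=
  (continuous_const.sub (continuous_z.mul continuous_const)).inv₀ (one_sub_z_mul_ne_zero ha)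

theorem integrable_of_continuous {φ : Freq → ℂ} (hφ : Continuous φ) : Integrable φ μ := by
  have := (memLp_const (μ := μ) (p := 1) (1 : ℂ)).continuous_mul hφ
  simpa using memLp_one_iff_integrable.mp this

theorem integrable_continuous_mul {φ f : Freq → ℂ} (hφ : Continuous φ) (hf : Integrable f μ) :
    Integrable (fun ω => φ ω * f ω) μ :=
  memLp_one_iff_integrable.mp ((memLp_one_iff_integrable.mpr hf).continuous_mul hφ)

theorem integral_z_pow (n : ℕ) : ∫ ω, z ω ^ n ∂μ = if n = 0 then 1 else 0 := by
  rcases n.eq_zero_or_pos with rfl | hn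
  · simp
  · have h := congrFun (fourierCoeff_fourier (T := 2 * Real.pi) 0) (-(n : ℤ))
    rw [fourierCoeff_eq_integral_z, Pi.single_eq_of_ne (by omega)] at h
    rw [if_neg hn.ne', ← h]
    congr! 2 with ω
    rw [fourier_zero, mul_one, neg_neg, zpow_natCast]

/-- Only the constant term of the geometric series `∑ (a z)ⁿ` survives integration; hence evaluation
fixes constants. -/
theorem integral_cauchyKernel (ha : |a| < 1) : ∫ ω, cauchyKernel a ω ∂μ = 1 := by
  have hnorm (n : ℕ) (ω : Freq) : ‖(z ω * a) ^ n‖ = |a| ^ n := by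
    rw [norm_pow, norm_mul, norm_z, one_mul, Complex.norm_real, Real.norm_eq_abs]
  have h := hasSum_integral_of_summable_integral_norm (μ := μ)
    (F := fun (n : ℕ) ω => (z ω * a) ^ n)
    (fun n => integrable_of_continuous ((continuous_z.mul continuous_const).pow n))
    (by simpa [hnorm] using summable_geometric_of_lt_one (abs_nonneg a) ha)
  have h0 : (fun n : ℕ => ∫ ω, (z ω * a) ^ n ∂μ) = fun n => if n = 0 then 1 else 0 := by
    ext n
    simp_rw [mul_pow]
    rw [integral_mul_const, integral_z_pow]
    split_ifs with hn
    · simp [hn]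
    · simp
  rw [h0] at h
  refine Eq.trans ?_ ((hasSum_ite_eq 0 (1 : ℂ)).unique h).symm
  congr! 2 with ω
  rw [tsum_geometric_of_norm_lt_one]
  · rfl
  · simpa using (hnorm 1 ω).trans_lt (by simpa using ha)

/-- Evaluation of causal functions is multiplicative. -/
theorem causalEval_mul (ha : |a| < 1) {f g : Freq → ℂ} (hf : IsHardy 2 f) (hg : IsHardy 2 g) :
    causalEval a (fun ω => f ω * g ω) = causalEval a f * causalEval a g := by
  set c := causalEval a f with hc
  have hκ := continuous_cauchyKernel ha
  have hf0 : MemLp (fun ω => f ω - c) 2 μ := hf.1.sub (memLp_const c)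
  have hf0i : Integrable (fun ω => f ω - c) μ := hf0.integrable one_le_two
  have hfi : Integrable f μ := hf.1.integrable one_le_two
  have hcausal (n : ℕ) : ∫ ω, (z ω)⁻¹ ^ (n + 1) * (f ω - c) ∂μ = 0 := by
    simp_rw [mul_sub]
    rw [integral_sub (integrable_continuous_mul (continuous_z_inv_pow _) hfi)
      (integrable_continuous_mul (continuous_z_inv_pow _) (integrable_const c)),
      (isCausal_iff_integral_z f).mp hf.2 n, (isCausal_iff_integral_z _).mp (isCausal_const c) n,
      sub_zero]
  -- Subtracting `c = f(1/a)` makes the moment at `n = 0` vanish; the others follow by induction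
  -- from `z⁻¹κ = z⁻¹ + aκ`, where `κ` is the Cauchy kernel, and the causality of `f - c`.
  have hJ (n : ℕ) : ∫ ω, (z ω)⁻¹ ^ n * (cauchyKernel a ω * (f ω - c)) ∂μ = 0 := by
    induction n with
    | zero =>
      simp_rw [pow_zero, one_mul, mul_sub]
      rw [integral_sub (integrable_continuous_mul hκ hfi)
        (integrable_continuous_mul hκ (integrable_const c)), integral_mul_const,
        integral_cauchyKernel ha, one_mul, hc, causalEval, sub_self]
    | succ n ih =>
      have hsplit (ω : Freq) : (z ω)⁻¹ ^ (n + 1) * (cauchyKernel a ω * (f ω - c)) =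
          (z ω)⁻¹ ^ (n + 1) * (f ω - c) +
            a * ((z ω)⁻¹ ^ n * (cauchyKernel a ω * (f ω - c))) := by
        have h1 := one_sub_z_mul_ne_zero ha ω
        have h2 := z_ne_zero ω
        rw [cauchyKernel, pow_succ]
        field_simp
        ring
      simp_rw [hsplit]
      rw [integral_add (integrable_continuous_mul (continuous_z_inv_pow _) hf0i)
        ((integrable_continuous_mul (continuous_z_inv_pow _)
          (integrable_continuous_mul hκ hf0i)).const_mul _), hcausal, integral_const_mul, ih,
        mul_zero, add_zero]
  -- The vanishing moment at `n = 0` leaves room for one extra factor `z`. The first positive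
  -- coefficient of the causal product of this function with `g` is `∫ κ (f - c) g`, which therefore
  -- vanishes.
  have hq : IsHardy 2 fun ω => z ω * (cauchyKernel a ω * (f ω - c)) := by
    refine ⟨(hf0.continuous_mul hκ).continuous_mul continuous_z, ?_⟩
    rw [isCausal_iff_integral_z]
    intro n
    rw [← hJ n]
    congr! 2 with ω
    have h2 := z_ne_zero ω
    rw [pow_succ]
    field_simp
  have h0 := (isCausal_iff_integral_z _).mp (hq.isCausal_mul hg) 0
  have hfg : Integrable (fun ω => f ω * g ω) μ := hf.1.integrable_mul hg.1
  have hgi : Integrable g μ := hg.1.integrable one_le_two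
  have h1 : ∫ ω, cauchyKernel a ω * (f ω * g ω) - c * (cauchyKernel a ω * g ω) ∂μ = 0 := by
    rw [← h0]
    congr! 2 with ω
    have h2 := z_ne_zero ω
    rw [zero_add, pow_one, mul_assoc (z ω), inv_mul_cancel_left₀ h2]
    ring
  rw [integral_sub (integrable_continuous_mul hκ hfg)
    ((integrable_continuous_mul hκ hgi).const_mul c), integral_const_mul] at h1
  exact sub_eq_zero.mp h1

/-- The maximum principle for causal functions. -/
theorem norm_causalEval_le_one (ha : |a| < 1) {h : Freq → ℂ} (hm : AEStronglyMeasurable h μ)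
    (hb : ∀ᵐ ω ∂μ, ‖h ω‖ ≤ 1) (hc : IsCausal h) : ‖causalEval a h‖ ≤ 1 := by
  have hpow_bound (n : ℕ) : ∀ᵐ ω ∂μ, ‖h ω ^ n‖ ≤ 1 := by
    filter_upwards [hb] with ω hω
    rw [norm_pow]
    exact pow_le_one₀ (norm_nonneg _) hω
  have hL2 (n : ℕ) : MemLp (fun ω => h ω ^ n) 2 μ := MemLp.of_bound (hm.pow n) 1 (hpow_bound n)
  have hh : IsHardy 2 h := ⟨by simpa using hL2 1, hc⟩
  have hpow (n : ℕ) : IsHardy 2 (fun ω => h ω ^ n) ∧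
      causalEval a (fun ω => h ω ^ n) = causalEval a h ^ n := by
    induction n with
    | zero =>
      simp only [pow_zero]
      refine ⟨⟨memLp_const 1, isCausal_const 1⟩, ?_⟩
      simp [causalEval, integral_cauchyKernel ha]
    | succ n ih =>
      simp only [pow_succ]
      refine ⟨⟨?_, ih.1.isCausal_mul hh⟩, ?_⟩
      · simpa only [pow_succ] using hL2 (n + 1)
      · rw [causalEval_mul ha ih.1 hh, ih.2]
  obtain ⟨C, hC⟩ := isCompact_univ.exists_bound_of_continuousOn
    (continuous_cauchyKernel ha).continuousOn
  -- Power trick: the kernel bound `C` is independent of `n`, and bounded powers force the modulus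
  -- to be at most one.
  have hle (n : ℕ) : ‖causalEval a h‖ ^ n ≤ C := by
    rw [← norm_pow, ← (hpow n).2]
    refine (norm_integral_le_of_norm_le_const (C := C) ?_).trans_eq (by simp)
    filter_upwards [hpow_bound n] with ω hω
    rw [norm_mul]
    have h1 := hC ω trivial
    have h2 := norm_nonneg (cauchyKernel a ω)
    nlinarith
  by_contra! hlt
  obtain ⟨n, hn⟩ := pow_unbounded_of_one_lt C hlt
  exact (hle n).not_gt hn

/-- The modulus of an outer function at a point outside the unit disc is monotone in its
modulus on the unit circle. -/
theorem IsSpectralFactor.norm_causalEval_le (ha : |a| < 1) {N₁ N₂ : Freq → ℝ} {L₁ L₂ : Freq → ℂ}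
    (h₁ : IsSpectralFactor N₁ L₁) (h₂ : IsSpectralFactor N₂ L₂) (hpos : ∀ ω, 0 < N₂ ω)
    (hle : ∀ ω, N₁ ω ≤ N₂ ω) : ‖causalEval a L₁‖ ≤ ‖causalEval a L₂‖ := by
  set h : Freq → ℂ := fun ω => L₁ ω / L₂ ω with hdef
  have hm : AEStronglyMeasurable h μ :=
    (h₁.hardy.1.1.aemeasurable.div h₂.hardy.1.1.aemeasurable).aestronglyMeasurable
  have hne : ∀ᵐ ω ∂μ, L₂ ω ≠ 0 := by
    filter_upwards [h₂.factor] with ω hω h0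
    rw [h0, norm_zero] at hω
    have := hpos ω
    norm_num at hω
    linarith
  have hb : ∀ᵐ ω ∂μ, ‖h ω‖ ≤ 1 := by
    filter_upwards [h₁.factor, h₂.factor, hne] with ω h1 h2 h3
    rw [hdef, norm_div, div_le_one (norm_pos_iff.mpr h3)]
    refine le_of_sq_le_sq ?_ (norm_nonneg _)
    rw [h1, h2]
    exact hle ω
  have hL2 : MemLp h 2 μ := MemLp.of_bound hm 1 hb
  have heq : L₁ =ᵐ[μ] fun ω => L₂ ω * h ω := by
    filter_upwards [hne] with ω hω
    rw [hdef, mul_div_cancel₀ _ hω]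
  have hc : IsCausal h := h₂.causallyInvertible h hL2 (h₁.hardy.congr_ae heq)
  have : causalEval a L₁ = causalEval a L₂ * causalEval a h := by
    rw [← causalEval_mul ha h₂.hardy ⟨hL2, hc⟩]
    refine integral_congr_ae ?_
    filter_upwards [heq] with ω hω
    rw [hω]
  rw [this, norm_mul]
  exact mul_le_of_le_one_right (norm_nonneg _) (norm_causalEval_le_one ha hm hb hc)

/-! ### Integrable functions with a single nonzero Fourier coefficient -/

/-- Integration against `f` is a bounded functional on continuous functions, and trigonometric
polynomials are dense there. -/
theorem integral_continuousMap_mul_eq_zero {f : Freq → ℂ} (hf : Integrable f μ)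
    (h : ∀ k : ℤ, ∫ ω, z ω ^ k * f ω ∂μ = 0) (g : C(Freq, ℂ)) : ∫ ω, g ω * f ω ∂μ = 0 := by
  have hint (g : C(Freq, ℂ)) : Integrable (fun ω => g ω * f ω) μ :=
    integrable_continuous_mul g.continuous hf
  let Φ : C(Freq, ℂ) →ₗ[ℂ] ℂ :=
    { toFun := fun g => ∫ ω, g ω * f ω ∂μ
      map_add' := fun g₁ g₂ => by
        simp only [ContinuousMap.add_apply, add_mul]
        exact integral_add (hint g₁) (hint g₂)
      map_smul' := fun c g => by
        simp only [ContinuousMap.smul_apply, smul_eq_mul, mul_assoc, RingHom.id_apply]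
        exact integral_const_mul c _ }
  have hΦ (g : C(Freq, ℂ)) : ‖Φ g‖ ≤ (∫ ω, ‖f ω‖ ∂μ) * ‖g‖ := by
    rw [← integral_mul_const]
    refine norm_integral_le_of_norm_le (hf.norm.mul_const _) (ae_of_all _ fun ω => ?_)
    rw [norm_mul, mul_comm]
    gcongr
    exact g.norm_coe_le_norm ω
  let Ψ : C(Freq, ℂ) →L[ℂ] ℂ := Φ.mkContinuous _ hΦ
  have hle : (Submodule.span ℂ (Set.range (@fourier (2 * Real.pi)))).topologicalClosure ≤
      Ψ.ker := by
    refine Submodule.topologicalClosure_minimal _ ?_ Ψ.isClosed_ker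
    rw [Submodule.span_le]
    rintro _ ⟨k, rfl⟩
    change ∫ ω, fourier k ω * f ω ∂μ = 0
    simp_rw [fourier_eq_z_zpow]
    exact h k
  rw [span_fourier_closure_eq_top] at hle
  exact hle (Submodule.mem_top (x := g))

/-- Since `f` is real, conjugation supplies the moments of the other sign. As `f` is only
integrable, Parseval is replaced by the fact that finite measures are determined by their integrals
of continuous functions. -/
theorem ae_eq_integral_of_integral_z_pow_mul {f : Freq → ℝ} (hf : Integrable f μ)
    (hf0 : ∀ ω, 0 ≤ f ω) (h : ∀ n : ℕ, ∫ ω, (z ω)⁻¹ ^ (n + 1) * (f ω : ℂ) ∂μ = 0) :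
    ∀ᵐ ω ∂μ, f ω = ∫ ω, f ω ∂μ := by
  set d := ∫ ω, f ω ∂μ with hd
  have hd0 : 0 ≤ d := integral_nonneg hf0
  have hfC : Integrable (fun ω => (f ω : ℂ)) μ := hf.ofReal
  have hz (n : ℕ) : ∫ ω, z ω ^ (n + 1) * (f ω : ℂ) ∂μ = 0 := by
    have h1 := congrArg (starRingEnd ℂ) (h n)
    rw [← integral_conj, map_zero] at h1
    rw [← h1]
    congr! 2 with ω
    rw [map_mul, map_pow, Complex.conj_ofReal, ← Complex.inv_eq_conj (by simp [norm_z]), inv_inv]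
  have hmom (k : ℤ) : ∫ ω, z ω ^ k * (f ω - d : ℂ) ∂μ = 0 := by
    have hsub : ∀ φ : Freq → ℂ, Continuous φ →
        ∫ ω, φ ω * (f ω - d : ℂ) ∂μ = ∫ ω, φ ω * (f ω : ℂ) ∂μ - (∫ ω, φ ω ∂μ) * d := by
      intro φ hφ
      simp_rw [mul_sub]
      rw [integral_sub (integrable_continuous_mul hφ hfC)
        (integrable_continuous_mul hφ (integrable_const _)), integral_mul_const]
    rcases lt_trichotomy k 0 with hk | rfl | hk
    · obtain ⟨n, rfl⟩ : ∃ n : ℕ, k = -((n + 1 : ℕ) : ℤ) := ⟨(-k - 1).toNat, by omega⟩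
      simp_rw [zpow_neg, zpow_natCast, ← inv_pow]
      rw [hsub _ (continuous_z_inv_pow _), h, integral_z_inv_pow_succ, zero_mul, sub_zero]
    · simp_rw [zpow_zero]
      rw [hsub _ continuous_const]
      simp [hd, integral_complex_ofReal]
    · obtain ⟨n, rfl⟩ : ∃ n : ℕ, k = ((n + 1 : ℕ) : ℤ) := ⟨(k - 1).toNat, by omega⟩
      simp_rw [zpow_natCast]
      rw [hsub (fun ω => z ω ^ (n + 1)) (continuous_z.pow _), hz, integral_z_pow,
        if_neg n.succ_ne_zero,
        zero_mul, sub_zero]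
  have hg (g : C(Freq, ℝ)) : ∫ ω, f ω * g ω ∂μ = d * ∫ ω, g ω ∂μ := by
    have hgi : Integrable g μ :=
      integrableOn_univ.mp (g.continuous.continuousOn.integrableOn_compact isCompact_univ)
    have h1 := integral_continuousMap_mul_eq_zero (hfC.sub (integrable_const (d : ℂ))) hmom
      ⟨fun ω => (g ω : ℂ), Complex.continuous_ofReal.comp g.continuous⟩
    have h2 : ∫ ω, (((f ω - d) * g ω : ℝ) : ℂ) ∂μ = 0 := by
      rw [← h1]
      congr! 2 with ω
      simp [mul_comm]
    rw [integral_complex_ofReal, Complex.ofReal_eq_zero] at h2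
    have hfg : Integrable (fun ω => f ω * g ω) μ := by
      obtain ⟨C, hC⟩ := isCompact_univ.exists_bound_of_continuousOn g.continuous.continuousOn
      exact hf.mul_bdd g.continuous.aestronglyMeasurable (ae_of_all _ fun ω => hC ω trivial)
    simp_rw [sub_mul] at h2
    rw [integral_sub hfg (hgi.const_mul d), integral_const_mul] at h2
    linarith
  have hm : AEMeasurable (fun ω => ENNReal.ofReal (f ω)) μ :=
    hf.aestronglyMeasurable.aemeasurable.ennreal_ofReal
  have hfin : ∫⁻ ω, ENNReal.ofReal (f ω) ∂μ ≠ ∞ := by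
    rw [← ofReal_integral_eq_lintegral_ofReal hf (ae_of_all _ hf0)]
    exact ENNReal.ofReal_ne_top
  have : IsFiniteMeasure (μ.withDensity fun ω => ENNReal.ofReal (f ω)) :=
    isFiniteMeasure_withDensity hfin
  have : IsFiniteMeasure (μ.withDensity fun _ => ENNReal.ofReal d) :=
    isFiniteMeasure_withDensity (by simp)
  have hmeas : (μ.withDensity fun ω => ENNReal.ofReal (f ω)) =
      μ.withDensity fun _ => ENNReal.ofReal d := by
    refine ext_of_forall_integral_eq_of_IsFiniteMeasure fun g => ?_
    rw [integral_withDensity_eq_integral_toReal_smul₀ hm (by simp),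
      integral_withDensity_eq_integral_toReal_smul₀ aemeasurable_const (by simp)]
    simp only [ENNReal.toReal_ofReal (hf0 _), ENNReal.toReal_ofReal hd0, smul_eq_mul]
    rw [integral_const_mul]
    exact hg g.toContinuousMap
  filter_upwards [(withDensity_eq_iff hm aemeasurable_const hfin).mp hmeas] with ω hω
  exact (ENNReal.ofReal_eq_ofReal_iff (hf0 ω) hd0).mp hω

/-! ### Szegő's lower bound -/

theorem z_coe (θ : ℝ) : z (θ : Freq) = circleMap 0 1 θ := by
  rw [z, fourier_coe_apply, circleMap]
  have : (Real.pi : ℂ) ≠ 0 := by exact_mod_cast Real.pi_ne_zero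
  simp only [Complex.ofReal_one, zero_add, one_mul]
  congr 1
  push_cast
  field_simp

open Polynomial in
theorem integrable_log_norm_eval_z (p : ℂ[X]) :
    Integrable (fun ω => Real.log ‖p.eval (z ω)‖) μ := by
  have h := p.intervalIntegrable_mahlerMeasure
  rw [intervalIntegrable_iff_integrableOn_Ioc_of_le Real.two_pi_pos.le] at h
  have hm : Measurable fun ω => Real.log ‖p.eval (z ω)‖ :=
    ((p.continuous.comp continuous_z).norm.measurable).log
  have hv : Integrable (fun ω => Real.log ‖p.eval (z ω)‖) (volume : Measure Freq) := by
    rw [← (AddCircle.measurePreserving_mk (2 * Real.pi) 0).map_eq, zero_add,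
      integrable_map_measure hm.aestronglyMeasurable
        AddCircle.measurable_mk'.aemeasurable]
    refine h.congr (ae_of_all _ fun θ => ?_)
    change _ = Real.log ‖p.eval (z (θ : Freq))‖
    rw [z_coe]
  rw [volume_eq_smul_haarAddCircle] at hv
  rwa [integrable_smul_measure (by simpa using Real.pi_pos)
    ENNReal.ofReal_ne_top] at hv

open Polynomial in
theorem integral_log_norm_eval_z (p : ℂ[X]) :
    ∫ ω, Real.log ‖p.eval (z ω)‖ ∂μ = p.logMahlerMeasure := by
  rw [integral_haarAddCircle, ← AddCircle.intervalIntegral_preimage _ 0, logMahlerMeasure_def,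
    Real.circleAverage_def, zero_add]
  simp_rw [z_coe]

open Polynomial in
-- Jensen's inequality for `|p|² N`, combined with `∫ log |p| ≥ 0`: the Mahler measure of `p` is at
-- least `|p(0)| = 1`.
theorem exp_integral_log_le {N : Freq → ℝ} (hN : IsPositiveSpectrum N) (p : ℂ[X])
    (hp : p.coeff 0 = 1) :
    Real.exp (∫ ω, Real.log (N ω) ∂μ) ≤ ∫ ω, ‖p.eval (z ω)‖ ^ 2 * N ω ∂μ := by
  have hp0 : p ≠ 0 := by
    rintro rfl
    simp at hp
  have hne : ∀ᵐ ω ∂μ, p.eval (z ω) ≠ 0 := by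
    have := ((p.roots.toFinset.finite_toSet).preimage (f := z) z_injective.injOn).measure_zero μ
    rw [ae_iff]
    refine measure_mono_null (fun ω hω => ?_) this
    simpa [hp0] using hω
  have hlog0 : 0 ≤ ∫ ω, Real.log ‖p.eval (z ω)‖ ∂μ := by
    rw [integral_log_norm_eval_z, logMahlerMeasure_eq_log_MahlerMeasure]
    refine Real.log_nonneg ?_
    simpa [hp] using p.norm_coeff_le_choose_mul_mahlerMeasure 0
  set I := ∫ ω, Real.log (N ω) ∂μ with hI
  have hc := Real.exp_pos (-I)
  have hint : Integrable (fun ω => ‖p.eval (z ω)‖ ^ 2 * N ω) μ := by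
    obtain ⟨C, hC⟩ := isCompact_univ.exists_bound_of_continuousOn
      (((p.continuous.comp continuous_z).norm.pow 2).continuousOn)
    exact hN.integrable.bdd_mul
      ((p.continuous.comp continuous_z).norm.pow 2).aestronglyMeasurable
      (ae_of_all _ fun ω => hC ω trivial)
  -- The tangent bound `1 + log x ≤ x` at `x = e^{-I} |p|² N`; integrating it gives Jensen's
  -- inequality.
  have hpt : ∀ᵐ ω ∂μ, 1 + (2 * Real.log ‖p.eval (z ω)‖ + Real.log (N ω) - I) ≤
      Real.exp (-I) * (‖p.eval (z ω)‖ ^ 2 * N ω) := by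
    filter_upwards [hne] with ω hω
    have h1 : 0 < ‖p.eval (z ω)‖ := norm_pos_iff.mpr hω
    have h2 := hN.pos ω
    have h3 : 0 < Real.exp (-I) * (‖p.eval (z ω)‖ ^ 2 * N ω) := by positivity
    have h4 := Real.log_le_sub_one_of_pos h3
    rw [Real.log_mul hc.ne' (by positivity), Real.log_mul (by positivity) h2.ne', Real.log_exp,
      Real.log_pow] at h4
    push_cast at h4
    linarith
  have hl := (integrable_log_norm_eval_z p).const_mul 2
  have hi2 : Integrable (fun ω => 2 * Real.log ‖p.eval (z ω)‖ + Real.log (N ω)) μ :=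
    hl.add hN.log_integrable
  have hi3 : Integrable (fun ω => 2 * Real.log ‖p.eval (z ω)‖ + Real.log (N ω) - I) μ :=
    hi2.sub (integrable_const _)
  have hi1 : Integrable
      (fun ω => 1 + (2 * Real.log ‖p.eval (z ω)‖ + Real.log (N ω) - I)) μ :=
    (integrable_const _).add hi3
  have hmono := integral_mono_ae hi1 (hint.const_mul _) hpt
  rw [integral_const_mul, integral_add (integrable_const _) hi3,
    integral_sub hi2 (integrable_const _),
    integral_add hl hN.log_integrable, integral_const_mul] at hmono
  simp only [integral_const, probReal_univ, smul_eq_mul, one_mul] at hmono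
  have h5 : 1 ≤ Real.exp (-I) * ∫ ω, ‖p.eval (z ω)‖ ^ 2 * N ω ∂μ := by linarith
  rw [Real.exp_neg, ← div_eq_inv_mul, one_le_div (Real.exp_pos _)] at h5
  exact h5

/-! ### Existence of the spectral factor -/

namespace IsPositiveSpectrum

variable {N : Freq → ℝ}

theorem memLp_sqrt (hN : IsPositiveSpectrum N) :
    MemLp (fun ω => ((Real.sqrt (N ω) : ℝ) : ℂ)) 2 μ := by
  have hm : AEStronglyMeasurable (fun ω => Real.sqrt (N ω)) μ :=
    hN.integrable.aestronglyMeasurable.aemeasurable.sqrt.aestronglyMeasurable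
  have h : MemLp (fun ω => Real.sqrt (N ω)) 2 μ := by
    rw [memLp_two_iff_integrable_sq hm]
    refine hN.integrable.congr (ae_of_all _ fun ω => ?_)
    exact (Real.sq_sqrt (hN.pos ω).le).symm
  exact h.ofReal

theorem memLp_shift (hN : IsPositiveSpectrum N) (k : ℕ) :
    MemLp (fun ω => (z ω)⁻¹ ^ k * ((Real.sqrt (N ω) : ℝ) : ℂ)) 2 μ :=
  hN.memLp_sqrt.continuous_mul (continuous_z_inv_pow k)

/-- The elements `e^{-jωk} √N` of `L²`. -/
def shift (hN : IsPositiveSpectrum N) (k : ℕ) : Lp ℂ 2 μ := (hN.memLp_shift k).toLp _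

/-- The closed span of the strictly delayed elements. -/
def past (hN : IsPositiveSpectrum N) : Submodule ℂ (Lp ℂ 2 μ) :=
  (Submodule.span ℂ (Set.range fun k => hN.shift (k + 1))).topologicalClosure

instance (hN : IsPositiveSpectrum N) : CompleteSpace hN.past :=
  (Submodule.isClosed_topologicalClosure _).completeSpace_coe

/-- The innovation: the component of `√N` orthogonal to the past. -/
def innovation (hN : IsPositiveSpectrum N) : Lp ℂ 2 μ :=
  hN.shift 0 - hN.past.starProjection (hN.shift 0)

theorem inner_innovation_shift_succ (hN : IsPositiveSpectrum N) (k : ℕ) :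
    inner ℂ hN.innovation (hN.shift (k + 1)) = 0 :=
  Submodule.starProjection_inner_eq_zero _ _
    (Submodule.le_topologicalClosure _ (Submodule.subset_span ⟨k, rfl⟩))

theorem inner_innovation_shift_zero (hN : IsPositiveSpectrum N) :
    inner ℂ hN.innovation (hN.shift 0) = ((‖hN.innovation‖ ^ 2 : ℝ) : ℂ) := by
  have h : hN.shift 0 = hN.innovation + hN.past.starProjection (hN.shift 0) := by
    rw [innovation, sub_add_cancel]
  rw [h, inner_add_right]
  have h0 : inner ℂ hN.innovation (hN.past.starProjection (hN.shift 0)) = 0 :=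
    Submodule.starProjection_inner_eq_zero _ _ (Submodule.starProjection_apply_mem _ _)
  rw [h0, add_zero, inner_self_eq_norm_sq_to_K]
  simp

/-- The innovation lies in the closed span of the present and the past. -/
theorem inner_innovation_eq_zero (hN : IsPositiveSpectrum N) (w : Lp ℂ 2 μ)
    (h : ∀ k, inner ℂ w (hN.shift k) = 0) :
    inner ℂ w hN.innovation = 0 := by
  have hle : hN.past ≤ (ℂ ∙ w)ᗮ := by
    refine Submodule.topologicalClosure_minimal _ ?_ (Submodule.isClosed_orthogonal _)
    rw [Submodule.span_le]
    rintro _ ⟨k, rfl⟩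
    exact Submodule.mem_orthogonal_singleton_iff_inner_right.mpr (h (k + 1))
  rw [innovation, inner_sub_right, h 0, Submodule.mem_orthogonal_singleton_iff_inner_right.mp
    (hle (Submodule.starProjection_apply_mem _ _)), sub_zero]

open Polynomial in
-- On the circle `z⁻¹` is the conjugate of `z`. The factor `X` records that delays are strict, so
-- that `1 - q X` has constant coefficient one.
theorem exists_polynomial_of_mem_span (hN : IsPositiveSpectrum N) {x : Lp ℂ 2 μ}
    (hx : x ∈ Submodule.span ℂ (Set.range fun k => hN.shift (k + 1))) :
    ∃ q : ℂ[X], x =ᵐ[μ] fun ω =>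
      (starRingEnd ℂ) ((q * X).eval (z ω)) * ((Real.sqrt (N ω) : ℝ) : ℂ) := by
  induction hx using Submodule.span_induction with
  | mem x hx =>
    obtain ⟨k, rfl⟩ := hx
    refine ⟨X ^ k, ?_⟩
    filter_upwards [(hN.memLp_shift (k + 1)).coeFn_toLp] with ω hω
    rw [shift, hω, ← pow_succ, eval_pow, eval_X, map_pow, Complex.inv_eq_conj (norm_z ω)]
  | zero =>
    refine ⟨0, ?_⟩
    exact (Lp.coeFn_zero ℂ 2 μ).trans (ae_of_all _ fun ω => by simp)
  | add x y _ _ hx hy =>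
    obtain ⟨p, hp⟩ := hx
    obtain ⟨q, hq⟩ := hy
    refine ⟨p + q, ?_⟩
    filter_upwards [Lp.coeFn_add x y, hp, hq] with ω h1 h2 h3
    rw [h1, Pi.add_apply, h2, h3, add_mul p q X, eval_add, map_add, add_mul]
  | smul c x _ hx =>
    obtain ⟨p, hp⟩ := hx
    refine ⟨C ((starRingEnd ℂ) c) * p, ?_⟩
    filter_upwards [Lp.coeFn_smul c x, hp] with ω h1 h2
    rw [h1, Pi.smul_apply, h2, mul_assoc (C _), eval_mul (p := C _), eval_C, map_mul,
      Complex.conj_conj, smul_eq_mul, mul_assoc]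

open Polynomial in
theorem exp_integral_log_le_norm_sub_sq (hN : IsPositiveSpectrum N) {x : Lp ℂ 2 μ}
    (hx : x ∈ Submodule.span ℂ (Set.range fun k => hN.shift (k + 1))) :
    Real.exp (∫ ω, Real.log (N ω) ∂μ) ≤ ‖hN.shift 0 - x‖ ^ 2 := by
  obtain ⟨q, hq⟩ := hN.exists_polynomial_of_mem_span hx
  refine (exp_integral_log_le hN (1 - q * X) (by simp)).trans_eq ?_
  have h : ((‖hN.shift 0 - x‖ ^ 2 : ℝ) : ℂ) =
      ((∫ ω, ‖(1 - q * X).eval (z ω)‖ ^ 2 * N ω ∂μ : ℝ) : ℂ) := by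
    have h1 := inner_self_eq_norm_sq_to_K (𝕜 := ℂ) (hN.shift 0 - x)
    rw [L2.inner_def] at h1
    push_cast
    rw [← integral_complex_ofReal]
    refine h1.symm.trans (integral_congr_ae ?_)
    filter_upwards [Lp.coeFn_sub (hN.shift 0) x, (hN.memLp_shift 0).coeFn_toLp, hq]
      with ω h1 h2 h3
    have h4 : (hN.shift 0 - x : Lp ℂ 2 μ) ω =
        (starRingEnd ℂ) ((1 - q * X).eval (z ω)) * ((Real.sqrt (N ω) : ℝ) : ℂ) := by
      rw [h1, Pi.sub_apply, shift, h2, h3, eval_sub, eval_one, map_sub, map_one]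
      ring
    rw [h4, inner_self_eq_norm_sq_to_K, norm_mul, RCLike.norm_conj, Complex.norm_real,
      Real.norm_of_nonneg (Real.sqrt_nonneg _)]
    norm_cast
    rw [mul_pow, Real.sq_sqrt (hN.pos ω).le]
    rfl
  exact_mod_cast h.symm

/-- Szegő's bound passes to the closure, so `√N` stays at positive distance from its past. -/
theorem norm_innovation_pos (hN : IsPositiveSpectrum N) : 0 < ‖hN.innovation‖ := by
  rw [norm_pos_iff]
  intro h
  have hmem : hN.shift 0 ∈ hN.past := by
    rw [sub_eq_zero.mp h]
    exact Submodule.starProjection_apply_mem _ _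
  have hcl : IsClosed {x : Lp ℂ 2 μ |
      Real.exp (∫ ω, Real.log (N ω) ∂μ) ≤ ‖hN.shift 0 - x‖ ^ 2} :=
    isClosed_le continuous_const ((continuous_const.sub continuous_id).norm.pow 2)
  have h1 : Real.exp (∫ ω, Real.log (N ω) ∂μ) ≤ ‖hN.shift 0 - hN.shift 0‖ ^ 2 :=
    closure_minimal (fun x hx => hN.exp_integral_log_le_norm_sub_sq hx) hcl hmem
  have h2 := Real.exp_pos (∫ ω, Real.log (N ω) ∂μ)
  rw [sub_self, norm_zero, zero_pow two_ne_zero] at h1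
  linarith

theorem inner_toLp_shift (hN : IsPositiveSpectrum N) {f : Freq → ℂ} (hf : MemLp f 2 μ) (k : ℕ) :
    inner ℂ (hf.toLp f) (hN.shift k) =
      ∫ ω, (starRingEnd ℂ) (f ω) * ((z ω)⁻¹ ^ k * ((Real.sqrt (N ω) : ℝ) : ℂ)) ∂μ :=
  L2_inner_toLp hf _

theorem inner_innovation_shift (hN : IsPositiveSpectrum N) (k : ℕ) :
    inner ℂ hN.innovation (hN.shift k) =
      ∫ ω, (starRingEnd ℂ) (hN.innovation ω) * ((z ω)⁻¹ ^ k * ((Real.sqrt (N ω) : ℝ) : ℂ)) ∂μ := by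
  rw [← hN.inner_toLp_shift (Lp.memLp _), Lp.toLp_coeFn]

theorem inner_toLp_innovation (hN : IsPositiveSpectrum N) {f : Freq → ℂ} (hf : MemLp f 2 μ) :
    inner ℂ (hf.toLp f) hN.innovation = ∫ ω, (starRingEnd ℂ) (f ω) * hN.innovation ω ∂μ := by
  rw [← L2_inner_toLp hf (Lp.memLp _), Lp.toLp_coeFn]

theorem conj_mul_innovation (hN : IsPositiveSpectrum N) (ω : Freq) :
    (starRingEnd ℂ) (hN.innovation ω) * hN.innovation ω = ((‖hN.innovation ω‖ ^ 2 : ℝ) : ℂ) := by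
  rw [Complex.conj_mul']
  norm_cast

theorem conj_z_pow (n : ℕ) (ω : Freq) : (starRingEnd ℂ) (z ω ^ n) = (z ω)⁻¹ ^ n := by
  rw [map_pow, Complex.inv_eq_conj (norm_z ω)]

/-- The innovation is white. -/
theorem norm_innovation_ae_eq (hN : IsPositiveSpectrum N) :
    ∀ᵐ ω ∂μ, ‖hN.innovation ω‖ = ‖hN.innovation‖ := by
  have hv := Lp.memLp hN.innovation
  have hint : Integrable (fun ω => ‖hN.innovation ω‖ ^ 2) μ :=
    (memLp_two_iff_integrable_sq_norm hv.1).mp hv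
  have hnorm : ∫ ω, ‖hN.innovation ω‖ ^ 2 ∂μ = ‖hN.innovation‖ ^ 2 := by
    have h := inner_self_eq_norm_sq_to_K (𝕜 := ℂ) hN.innovation
    rw [L2.inner_def] at h
    have h2 : ∫ ω, ((‖hN.innovation ω‖ ^ 2 : ℝ) : ℂ) ∂μ = ((‖hN.innovation‖ ^ 2 : ℝ) : ℂ) := by
      push_cast
      refine Eq.trans ?_ h
      congr! 2 with ω
      rw [inner_self_eq_norm_sq_to_K]
      rfl
    rw [integral_complex_ofReal] at h2
    exact_mod_cast h2
  have h := ae_eq_integral_of_integral_z_pow_mul hint (fun ω => by positivity) (fun n => ?_)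
  · filter_upwards [h] with ω hω
    rw [hnorm] at hω
    exact (sq_eq_sq₀ (norm_nonneg _) (norm_nonneg _)).mp hω
  · have hw : MemLp (fun ω => z ω ^ (n + 1) * hN.innovation ω) 2 μ :=
      hv.continuous_mul (continuous_z.pow (n + 1))
    -- Moving `z^{n+1}` across the inner product turns delay `k` into delay `k + n + 1`, to which
    -- `v` is orthogonal. So `z^{n+1} v` is orthogonal to `v`: the corresponding moment of `|v|²` is
    -- zero.
    have h0 := hN.inner_innovation_eq_zero (hw.toLp _) (fun k => by
      rw [hN.inner_toLp_shift, ← hN.inner_innovation_shift_succ (k + n), inner_innovation_shift]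
      congr! 2 with ω
      rw [map_mul, conj_z_pow]
      ring)
    rw [inner_toLp_innovation] at h0
    rw [← h0]
    congr! 2 with ω
    rw [map_mul, conj_z_pow, mul_assoc, conj_mul_innovation]

/-- The spectral factor built from the innovation. -/
def factor (hN : IsPositiveSpectrum N) (ω : Freq) : ℂ :=
  (starRingEnd ℂ) (hN.innovation ω) * ((Real.sqrt (N ω) : ℝ) : ℂ) / ‖hN.innovation‖

theorem norm_factor_ae_eq (hN : IsPositiveSpectrum N) :
    ∀ᵐ ω ∂μ, ‖hN.factor ω‖ = Real.sqrt (N ω) := by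
  have hd := hN.norm_innovation_pos
  filter_upwards [hN.norm_innovation_ae_eq] with ω hω
  rw [factor, norm_div, norm_mul, RCLike.norm_conj, hω, Complex.norm_real, Complex.norm_real,
    Real.norm_of_nonneg (Real.sqrt_nonneg _), norm_norm]
  field_simp

/-- The conjugate in `factor` makes its moments inner products with the delays: causality is then
orthogonality to the past. -/
theorem integral_z_inv_pow_mul_factor (hN : IsPositiveSpectrum N) (k : ℕ) :
    ∫ ω, (z ω)⁻¹ ^ k * hN.factor ω ∂μ =
      inner ℂ hN.innovation (hN.shift k) / ‖hN.innovation‖ := by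
  rw [inner_innovation_shift, ← integral_div]
  congr! 2 with ω
  rw [factor]
  ring

theorem memLp_factor (hN : IsPositiveSpectrum N) : MemLp hN.factor 2 μ := by
  have hm : AEStronglyMeasurable hN.factor μ := by
    have h1 := (memLp_conj (Lp.memLp hN.innovation)).1
    exact ((h1.mul hN.memLp_sqrt.1).aemeasurable.div_const _).aestronglyMeasurable
  refine hN.memLp_sqrt.congr_norm hm ?_
  filter_upwards [hN.norm_factor_ae_eq] with ω hω
  rw [hω, Complex.norm_real, Real.norm_of_nonneg (Real.sqrt_nonneg _)]

/-- Causality of `L g` makes `z^{n+1} v conj g` orthogonal to every delay of `√N`, hence to `v`.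
Since `|v|` is constant, this says that a moment of `g` vanishes. -/
theorem isCausallyInvertible_factor (hN : IsPositiveSpectrum N) :
    IsCausallyInvertible hN.factor := by
  intro g hg hLg
  have hd := hN.norm_innovation_pos
  have hdC : (‖hN.innovation‖ : ℂ) ≠ 0 := by exact_mod_cast hd.ne'
  rw [isCausal_iff_integral_z]
  intro n
  have hvg : MemLp (fun ω => hN.innovation ω * (starRingEnd ℂ) (g ω)) 2 μ := by
    refine MemLp.of_le_mul (c := ‖hN.innovation‖) hg
      ((Lp.memLp hN.innovation).1.mul (memLp_conj hg).1) ?_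
    filter_upwards [hN.norm_innovation_ae_eq] with ω hω
    rw [norm_mul, hω, RCLike.norm_conj]
  have hw := hvg.continuous_mul (continuous_z.pow (n + 1))
  have h0 := hN.inner_innovation_eq_zero (hw.toLp _) (fun k => by
    rw [hN.inner_toLp_shift]
    have h1 := (isCausal_iff_integral_z _).mp hLg.2 (n + k)
    have h2 : ∫ ω, (‖hN.innovation‖ : ℂ) *
        ((z ω)⁻¹ ^ (n + k + 1) * (hN.factor ω * g ω)) ∂μ = 0 := by
      rw [integral_const_mul, h1, mul_zero]
    rw [← h2]
    congr! 2 with ω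
    simp only [Pi.pow_apply]
    rw [map_mul, conj_z_pow, map_mul, Complex.conj_conj, factor]
    field_simp
    ring)
  rw [inner_toLp_innovation] at h0
  have h3 : ∫ ω, ((‖hN.innovation‖ ^ 2 : ℝ) : ℂ) * ((z ω)⁻¹ ^ (n + 1) * g ω) ∂μ = 0 := by
    rw [← h0]
    refine integral_congr_ae ?_
    filter_upwards [hN.norm_innovation_ae_eq] with ω hω
    rw [← hω, ← conj_mul_innovation]
    simp only [Pi.pow_apply]
    rw [map_mul, conj_z_pow, map_mul, Complex.conj_conj]
    ring
  rw [integral_const_mul, mul_eq_zero] at h3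
  exact h3.resolve_left (by exact_mod_cast (pow_pos hd 2).ne')

theorem isSpectralFactor_factor (hN : IsPositiveSpectrum N) : IsSpectralFactor N hN.factor := by
  have hd := hN.norm_innovation_pos
  have h0 : fourierCoeff hN.factor 0 = ((‖hN.innovation‖ : ℝ) : ℂ) := by
    have h := hN.integral_z_inv_pow_mul_factor 0
    rw [inner_innovation_shift_zero] at h
    rw [fourierCoeff_eq_integral_z]
    simp only [neg_zero, zpow_zero]
    simp only [pow_zero] at h
    rw [h, ← Complex.ofReal_div]
    congr 1
    field_simp
  refine ⟨⟨hN.memLp_factor, ?_⟩, hN.isCausallyInvertible_factor, ?_, ?_, ?_⟩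
  · rw [isCausal_iff_integral_z]
    intro n
    rw [integral_z_inv_pow_mul_factor, inner_innovation_shift_succ, zero_div]
  · filter_upwards [hN.norm_factor_ae_eq] with ω hω
    rw [hω, Real.sq_sqrt (hN.pos ω).le]
  · rw [h0, Complex.ofReal_re]
    exact hd
  · rw [h0, Complex.ofReal_im]

/-- Szegő's theorem: `F₃ N` is a spectral factor of every positive spectrum `N`. -/
theorem isSpectralFactor_F₃ (hN : IsPositiveSpectrum N) : IsSpectralFactor N (F₃ N) := by
  have h : ∃ L, IsSpectralFactor N L := ⟨_, hN.isSpectralFactor_factor⟩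
  rw [F₃, dif_pos h]
  exact h.choose_spec

end IsPositiveSpectrum

/-! ### `B̄` as an evaluation of the spectral factor, and the conclusion -/

theorem ScalarSystem.F₄_eq {m : ℕ} (sys : ScalarSystem m) (L : Freq → ℂ) :
    sys.F₄ L = sys.Dbar * causalEval sys.Abar L := by
  rw [F₄, causalEval, ← integral_const_mul]
  congr! 2 with ω
  rw [cauchyKernel]
  ring

end MixedControl

end

theorem lemma2 {m : ℕ} (sys : MixedControl.ScalarSystem m)
    (γ : ℝ) (hγ : sys.gammaInf < ENNReal.ofReal γ)
    (N₁ N₂ : MixedControl.Freq → ℝ)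
    (hN₁ : MixedControl.IsPositiveSpectrum N₁) (hN₂ : MixedControl.IsPositiveSpectrum N₂)
    (hle : ∀ ω, N₁ ω ≤ N₂ ω) :
    ∀ ω, (sys.F₂ γ ∘ sys.F₁ ∘ sys.F₄ ∘ MixedControl.F₃) N₁ ω ≤
      (sys.F₂ γ ∘ sys.F₁ ∘ sys.F₄ ∘ MixedControl.F₃) N₂ ω := by
  intro ω
  refine sys.F₂_F₁_le hγ ?_ ω
  rw [Function.comp_apply, Function.comp_apply, sys.F₄_eq, sys.F₄_eq, norm_mul, norm_mul]
  gcongr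
  exact hN₁.isSpectralFactor_F₃.norm_causalEval_le sys.abs_Abar_lt_one hN₂.isSpectralFactor_F₃
    hN₂.pos hle
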